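/- Let $d\ge 1$. Let $\mathbb M$ be the space of Borel simple point measures on $\mathbb R^d$ (Borel measures with values in $\{0,1,2,\dots,\infty\}$ that are finite on compact sets and satisfy $\mu(\{x\})\le 1$ for all $x$), with the smallest $\sigma$-field making all maps $\mu\mapsto\mu(B)$, $B$ Borel, measurable. Write $\mu|_A(\cdot)=\mu(\cdot\cap A)$ and $\theta(\mu)=\mu\circ\theta^{-1}$ for an isometry $\theta$ of $\mathbb R^d$. Let $\mathfrak F$ be the set of closed subsets of $\mathbb R^d$ with the Effros $\sigma$-field, generated by the sets $\{F\in\mathfrak F: F\cap K\ne\emptyset\}$, $K$ compact. For $R>0$, an *$R$-selection rule* is a measurable map $\Psi:\mathbb M\to\mathfrak F$ such that (a) for every $\lambda>0$, if $X$ is a homogeneous Poisson point process on $\mathbb R^d$ with intensity $\lambda$, then almost surely $\Psi(X)$ is a non-empty union of disjoint closed balls of radius $R$ (called the globes); (b) $\Psi(\theta\mu)=\theta\Psi(\mu)$ for all isometries $\theta$ of $\mathbb R^d$ and all $\mu\in\mathbb M$; (c) for all $\mu,\mu'\in\mathbb M$, if $\mu$ and $\mu'$ agree on $H(\mu):=\bigl(\bigcup_{x\in\Psi(\mu)}\bar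 B(x,2)\bigr)^c$, then $\Psi(\mu)=\Psi(\mu')$. **Proposition (Key equality).** Let $R>0$ and let $\Psi$ be an $R$-selection rule. Let $X,W:\Omega\to\mathbb M$ be independent homogeneous Poisson point processes on $\mathbb R^d$ with the same intensity $\lambda\ge 0$, defined on a probability space $(\Omega,\mathcal F,\mathbf P)$. Put $$Z:=W|_{\Psi(X)}+X|_{\Psi(X)^c}.$$ Then $Z$ has the same law as $X$, and $\Psi(Z)=\Psi(X)$ everywhere on $\Omega$. Moreover, conditionally on $\Psi(X)$, the process $X|_{\Psi(X)}$ is a Poisson point process of intensity $\lambda$ on $\Psi(X)$ and is independent of $X|_{\Psi(X)^c}$; that is, for all measurable $\mathcal A,\mathcal B\subset\mathbb M$, for $\mathbf P$-almost every $\omega$, $$\mathbf P\bigl(X|_{\Psi(X)}\in\mathcal A,\ X|_{\Psi(X)^c}\in\mathcal B\bigm|\sigma(\Psi(X))\bigr)(\omega)=\mathbf P\bigl(\omega':W(\omega')|_{\Psi(X(\omega))}\in\mathcal A\bigr)\cdot\mathbf P\bigl(X|_{\Psi(X)^c}\in\mathcal B\bigm|\sigma(\Psi(X))\bigr)(\omega).$$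 -/

import Mathlib

open MeasureTheory ProbabilityTheory TopologicalSpace
open scoped NNReal ENNReal

/-- Borel simple point measures on `ℝ^d`: Borel measures with values in `{0, 1, 2, …, ∞}` that are
finite on compact sets and give mass at most one to every point. -/
structure SimplePointMeasure (d : ℕ) where
  toMeasure : Measure (EuclideanSpace ℝ (Fin d))
  integer_valued : ∀ B, MeasurableSet B → ∃ n : ℕ∞, toMeasure B = (n : ℝ≥0∞)
  locally_finite : ∀ K, IsCompact K → toMeasure K < ∞
  simple : ∀ x, toMeasure {x} ≤ 1

namespace SimplePointMeasure

variable {d : ℕ}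

/-- The smallest σ-field for which all projections `μ ↦ μ(B)`, `B` Borel, are measurable. -/
instance : MeasurableSpace (SimplePointMeasure d) :=
  ⨆ (B : Set (EuclideanSpace ℝ (Fin d))) (_ : MeasurableSet B),
    MeasurableSpace.comap (fun μ => μ.toMeasure B) inferInstance

theorem exists_eq_natCast (μ : SimplePointMeasure d) (B : Set (EuclideanSpace ℝ (Fin d))) :
    ∃ n : ℕ∞, μ.toMeasure B = (n : ℝ≥0∞) := by
  obtain ⟨n, hn⟩ := μ.integer_valued _ (measurableSet_toMeasurable μ.toMeasure B)
  exact ⟨n, by rw [← hn, measure_toMeasurable]⟩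

/-- The restriction `μ|_A`, that is, `B ↦ μ(B ∩ A)`. -/
noncomputable def restrict (μ : SimplePointMeasure d) (A : Set (EuclideanSpace ℝ (Fin d))) :
    SimplePointMeasure d where
  toMeasure := μ.toMeasure.restrict A
  integer_valued B hB := by
    rw [Measure.restrict_apply hB]
    exact μ.exists_eq_natCast _
  locally_finite K hK := (Measure.restrict_apply_le A K).trans_lt (μ.locally_finite K hK)
  simple x := (Measure.restrict_apply_le A {x}).trans (μ.simple x)

/-- The image `θ(μ)` under an isometry `θ`, that is, `B ↦ μ(θ⁻¹(B))`. -/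
noncomputable def map (θ : EuclideanSpace ℝ (Fin d) ≃ᵢ EuclideanSpace ℝ (Fin d))
    (μ : SimplePointMeasure d) : SimplePointMeasure d where
  toMeasure := μ.toMeasure.map θ
  integer_valued B hB := by
    rw [Measure.map_apply θ.continuous.measurable hB]
    exact μ.exists_eq_natCast _
  locally_finite K hK := by
    rw [Measure.map_apply θ.continuous.measurable hK.measurableSet]
    exact μ.locally_finite _ (θ.toHomeomorph.isCompact_preimage.2 hK)
  simple x := by
    rw [Measure.map_apply θ.continuous.measurable (measurableSet_singleton x)]
    have : θ ⁻¹' {x} = {θ.symm x} := by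
      ext y
      simp only [Set.mem_preimage, Set.mem_singleton_iff]
      exact ⟨fun h => by rw [← h, θ.symm_apply_apply], fun h => by rw [h, θ.apply_symm_apply]⟩
    rw [this]
    exact μ.simple _

/-- The point measure `ν|_F + μ|_{Fᶜ}` for a closed set `F`. -/
noncomputable def glue (F : Closeds (EuclideanSpace ℝ (Fin d))) (ν μ : SimplePointMeasure d) :
    SimplePointMeasure d where
  toMeasure := ν.toMeasure.restrict F + μ.toMeasure.restrict (F : Set _)ᶜ
  integer_valued B hB := by
    obtain ⟨m, hm⟩ := (ν.restrict F).integer_valued B hB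
    obtain ⟨n, hn⟩ := (μ.restrict (F : Set _)ᶜ).integer_valued B hB
    refine ⟨m + n, ?_⟩
    rw [Measure.add_apply, ENat.toENNReal_add, ← hm, ← hn]
    rfl
  locally_finite K hK := by
    rw [Measure.add_apply]
    exact ENNReal.add_lt_top.2
      ⟨(Measure.restrict_apply_le _ K).trans_lt (ν.locally_finite K hK),
        (Measure.restrict_apply_le _ K).trans_lt (μ.locally_finite K hK)⟩
  simple x := by
    rw [Measure.add_apply, Measure.restrict_apply (measurableSet_singleton x),
      Measure.restrict_apply (measurableSet_singleton x)]
    by_cases hx : x ∈ (F : Set (EuclideanSpace ℝ (Fin d)))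
    · rw [Set.inter_eq_left.2 (Set.singleton_subset_iff.2 hx),
        Set.singleton_inter_eq_empty.2 (by simpa using hx), measure_empty, add_zero]
      exact ν.simple x
    · rw [Set.singleton_inter_eq_empty.2 hx, measure_empty, zero_add,
        Set.inter_eq_left.2 (Set.singleton_subset_iff.2 hx)]
      exact μ.simple x

end SimplePointMeasure

/-- `Q` is the law of a homogeneous Poisson point process on `ℝ^d` with intensity `lam`: the number
of points in a Borel set `B` of finite Lebesgue measure is Poisson with mean `lam * volume B`, and
the numbers of points in disjoint Borel sets are independent. -/
structure IsPoissonLaw {d : ℕ} (lam : ℝ≥0) (Q : Measure (SimplePointMeasure d)) : Prop where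
  count_law : ∀ B : Set (EuclideanSpace ℝ (Fin d)), MeasurableSet B → volume B ≠ ∞ →
    Q.map (fun μ => μ.toMeasure B) =
      (poissonMeasure (lam * (volume B).toNNReal)).map (fun n : ℕ => (n : ℝ≥0∞))
  count_indep : ∀ (n : ℕ) (B : Fin n → Set (EuclideanSpace ℝ (Fin d))),
    (∀ i, MeasurableSet (B i)) → Pairwise (fun i j => Disjoint (B i) (B j)) →
    iIndepFun (fun (i : Fin n) (μ : SimplePointMeasure d) => μ.toMeasure (B i)) Q

/-- `X` is a homogeneous Poisson point process on `ℝ^d` with intensity `lam`, defined on the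
probability space `(Ω, P)`. -/
structure IsPoissonProcess {d : ℕ} {Ω : Type*} [MeasurableSpace Ω] (lam : ℝ≥0)
    (X : Ω → SimplePointMeasure d) (P : Measure Ω) : Prop where
  measurable : Measurable X
  law : IsPoissonLaw lam (P.map X)

/-- The Effros σ-field on the closed subsets of `ℝ^d`, generated by the sets
`{F | F ∩ K ≠ ∅}`, `K` compact. -/
instance effrosMeasurableSpace (d : ℕ) : MeasurableSpace (Closeds (EuclideanSpace ℝ (Fin d))) :=
  MeasurableSpace.generateFrom
    {S | ∃ K : Set (EuclideanSpace ℝ (Fin d)), IsCompact K ∧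
      S = {F : Closeds (EuclideanSpace ℝ (Fin d)) | ((F : Set _) ∩ K).Nonempty}}

/-- The set `H_Ψ(μ)`: the complement of the union of the balls of radius `2` centred in `Ψ(μ)`. -/
def selectionHull {d : ℕ} (Ψ : SimplePointMeasure d → Closeds (EuclideanSpace ℝ (Fin d)))
    (μ : SimplePointMeasure d) : Set (EuclideanSpace ℝ (Fin d)) :=
  (⋃ x ∈ (Ψ μ : Set (EuclideanSpace ℝ (Fin d))), Metric.closedBall x 2)ᶜ

/-- `R`-selection rules. -/
structure IsSelectionRule {d : ℕ} (R : ℝ)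
    (Ψ : SimplePointMeasure d → Closeds (EuclideanSpace ℝ (Fin d))) : Prop where
  /-- Under every Poisson law of positive intensity, `Ψ(μ)` is almost surely a non-empty union of
  disjoint closed balls of radius `R`. -/
  balls : ∀ lam : ℝ≥0, 0 < lam → ∀ Q : Measure (SimplePointMeasure d), IsPoissonLaw lam Q →
    ∀ᵐ μ ∂Q, ∃ C : Set (EuclideanSpace ℝ (Fin d)), C.Nonempty ∧
      C.PairwiseDisjoint (fun c => Metric.closedBall c R) ∧
      (Ψ μ : Set (EuclideanSpace ℝ (Fin d))) = ⋃ c ∈ C, Metric.closedBall c R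
  equivariant : ∀ (θ : EuclideanSpace ℝ (Fin d) ≃ᵢ EuclideanSpace ℝ (Fin d))
    (μ : SimplePointMeasure d), (Ψ (μ.map θ) : Set (EuclideanSpace ℝ (Fin d))) = θ '' (Ψ μ)
  determined : ∀ μ μ' : SimplePointMeasure d,
    μ.restrict (selectionHull Ψ μ) = μ'.restrict (selectionHull Ψ μ) → Ψ μ = Ψ μ'
  measurable : Measurable Ψ

open Filter Topology MeasurableSpace

/-! ### Counting points by refining countable partitions. -/

section CountablePartition

variable {α : Type*} [MeasurableSpace α] [CountablyGenerated α]

/-! For a deterministic closed set `F`, resampling a Poisson process inside `F` preserves its law: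
by Rényi's theorem (`ext_of_void`) it suffices to compare void probabilities, and these factor over
`B ∩ F` and `B ∩ Fᶜ`.

The set `Ψ(X)` is random, but it behaves like a stopping set: by condition (c) it is unaffected by
changing the points within distance 2 of it. It is approximated from outside by a finite union `D_n`
of small balls, those of a fixed finite family that meet `Ψ(X)`. Then `D_n` takes countably many
values and stays within distance 2 of `Ψ(X)`, so resampling inside `D_n` does not change which value
is taken (`hits_apply_glue_iff`). Splitting over the values reduces the claim to deterministic sets
(`map_glue_gridUnion`). As `n → ∞`, void events stabilise pointwise, which gives the law of `Z`
(`IsSelectionRule.map_glue`).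

Since `Ψ(Z) = Ψ(X)`, replacing `X` by `Z` turns the configuration inside the globes into that of
`W`, which is independent of `X`, and leaves the outside alone. Fubini then gives the conditional
statement (`measure_restrict_inter`). -/

theorem countablePartitionSet_succ_subset (n : ℕ) (x : α) :
    countablePartitionSet (n + 1) x ⊆ countablePartitionSet n x := by
  have h := countablePartitionSet_mem (n + 1) x
  have hx := mem_countablePartitionSet (n + 1) x
  simp only [countablePartition, memPartition_succ, Set.mem_ofPred_eq] at h
  obtain ⟨u, hu, h⟩ := h
  have hsub : countablePartitionSet (n + 1) x ⊆ u := by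
    rcases h with h | h <;> rw [h]
    · exact Set.inter_subset_left
    · exact Set.sdiff_subset
  rwa [countablePartitionSet_of_mem hu (hsub hx)]

/-- The partitions together generate the σ-field, so two points that share a cell at every level are
not separated by any measurable set. -/
theorem iInter_countablePartitionSet [SeparatesPoints α] (x : α) :
    ⋂ n, countablePartitionSet n x = {x} := by
  refine Set.Subset.antisymm (fun y hy => ?_) (fun y hy => ?_)
  · have hS : @SeparatesPoints α (generateFrom (⋃ n, countablePartition α n)) := by
      rw [generateFrom_iUnion_countablePartition]; infer_instance
    refine @separating_of_generateFrom α (⋃ n, countablePartition α n) hS y x fun s hs => ?_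
    obtain ⟨n, hn⟩ := Set.mem_iUnion.1 hs
    have hyn := Set.mem_iInter.1 hy n
    rw [← countablePartitionSet_eq_iff y hn, ← countablePartitionSet_eq_iff x hn,
      countablePartitionSet_of_mem (countablePartitionSet_mem n x) hyn]
  · rw [Set.mem_singleton_iff.1 hy]
    exact Set.mem_iInter.2 fun n => mem_countablePartitionSet n x

theorem measurableSet_of_countablePartitionSet (n : ℕ) (p : Set α → Prop) :
    MeasurableSet {x | p (countablePartitionSet n x)} := by
  have : {x | p (countablePartitionSet n x)} = ⋃ C ∈ {C ∈ countablePartition α n | p C}, C := by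
    ext x
    simp only [Set.mem_ofPred_eq, Set.mem_iUnion, exists_prop]
    exact ⟨fun h => ⟨_, ⟨countablePartitionSet_mem n x, h⟩, mem_countablePartitionSet n x⟩,
      fun ⟨C, ⟨hC, h⟩, hx⟩ => by rwa [countablePartitionSet_of_mem hC hx]⟩
  rw [this]
  exact MeasurableSet.biUnion ((finite_countablePartition α n).subset fun C hC => hC.1).countable
    fun C hC => measurableSet_countablePartition n hC.1

/-- A finite integer valued measure without multiple points counts, for all fine partitions, the
number of partition sets which it charges. -/
theorem eventually_measure_univ_eq_sum_countablePartition [SeparatesPoints α] (ν : Measure α)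
    [IsFiniteMeasure ν] (hν : ∀ B, ∃ n : ℕ∞, ν B = (n : ℝ≥0∞)) (hs : ∀ x, ν {x} ≤ 1) :
    ∀ᶠ n in atTop, (∑ C ∈ (finite_countablePartition α n).toFinset, if ν C = 0 then 0 else 1)
      = ν Set.univ := by
  classical
  -- `T n` collects the points whose cell is overcharged. The `T n` decrease to `∅` because cells
  -- shrink to single points of mass at most 1, so `ν (T n) → 0`; being an integer, it is eventually
  -- 0, and then every cell has mass 0 or 1.
  set T : ℕ → Set α := fun n => {x | 1 < ν (countablePartitionSet n x)} with hT
  have hTm : ∀ n, MeasurableSet (T n) := fun n =>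
    measurableSet_of_countablePartitionSet n fun C => 1 < ν C
  have hTa : Antitone T := antitone_nat_of_succ_le fun n x hx =>
    lt_of_lt_of_le hx (measure_mono (countablePartitionSet_succ_subset n x))
  have hTe : ⋂ n, T n = ∅ := by
    refine Set.eq_empty_of_forall_notMem fun x hx => ?_
    have hx' := fun n => Set.mem_iInter.1 hx n
    have hanti : Antitone fun n => countablePartitionSet n x :=
      antitone_nat_of_succ_le fun n => countablePartitionSet_succ_subset n x
    have ht := tendsto_measure_iInter_atTop (μ := ν)
      (fun n => (measurableSet_countablePartitionSet n x).nullMeasurableSet) hanti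
      ⟨0, measure_ne_top _ _⟩
    rw [iInter_countablePartitionSet] at ht
    have h2 : ∀ n, 2 ≤ ν (countablePartitionSet n x) := fun n => by
      have h := hx' n
      simp only [hT, Set.mem_ofPred_eq] at h
      obtain ⟨k, hk⟩ := hν (countablePartitionSet n x)
      rw [hk] at h ⊢
      have : (1 : ℕ∞) < k := by exact_mod_cast h
      have : (2 : ℕ∞) ≤ k := by
        simpa [one_add_one_eq_two] using Order.add_one_le_of_lt this
      exact_mod_cast this
    have := (ge_of_tendsto' ht h2).trans (hs x)
    norm_num at this
  have ht := tendsto_measure_iInter_atTop (μ := ν) (fun n => (hTm n).nullMeasurableSet) hTa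
    ⟨0, measure_ne_top _ _⟩
  rw [hTe, measure_empty] at ht
  filter_upwards [ht.eventually_lt_const one_pos] with n hn
  have hTn : ν (T n) = 0 := by
    obtain ⟨k, hk⟩ := hν (T n)
    simp only [Function.comp_apply] at hn
    rw [hk] at hn ⊢
    have : k < 1 := by exact_mod_cast hn
    rw [Order.lt_one_iff] at this
    simp [this]
  have hle : ∀ C ∈ countablePartition α n, ν C ≤ 1 := fun C hC => by
    by_contra! h
    have : C ⊆ T n := fun x hx => by
      simp only [hT, Set.mem_ofPred_eq, countablePartitionSet_of_mem hC hx, h]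
    have := (measure_mono this).trans_eq hTn
    exact absurd (h.trans_le this) (by simp)
  have hU : Set.univ = ⋃ C ∈ (finite_countablePartition α n).toFinset, C := by
    simp only [Set.Finite.mem_toFinset, ← Set.sUnion_eq_biUnion, sUnion_countablePartition]
  rw [hU, measure_biUnion_finset]
  · refine Finset.sum_congr rfl fun C hC => ?_
    split_ifs with h
    · exact h.symm
    · have h1 := hle C ((Set.Finite.mem_toFinset _).1 hC)
      obtain ⟨k, hk⟩ := hν C
      rw [hk] at h h1 ⊢
      have h1' : k ≤ 1 := by exact_mod_cast h1
      have h0' : k ≠ 0 := by rintro rfl; simp at h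
      rw [le_antisymm h1' (Order.one_le_iff_pos.2 (pos_iff_ne_zero.2 h0'))]
      simp
  · intro C hC D hD hCD
    exact disjoint_countablePartition ((Set.Finite.mem_toFinset _).1 hC)
      ((Set.Finite.mem_toFinset _).1 hD) hCD
  · intro C hC
    exact measurableSet_countablePartition n ((Set.Finite.mem_toFinset _).1 hC)

end CountablePartition

/-! ### The σ-field on point measures and Rényi's theorem. -/

namespace SimplePointMeasure

variable {d : ℕ}

theorem toMeasure_injective :
    Function.Injective (toMeasure : SimplePointMeasure d → Measure (EuclideanSpace ℝ (Fin d))) := by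
  rintro ⟨μ, _, _, _⟩ ⟨ν, _, _, _⟩ rfl
  rfl

theorem measurable_apply {B : Set (EuclideanSpace ℝ (Fin d))} (hB : MeasurableSet B) :
    Measurable fun μ : SimplePointMeasure d => μ.toMeasure B := by
  intro s hs
  exact (le_iSup₂ (f := fun (B : Set (EuclideanSpace ℝ (Fin d))) (_ : MeasurableSet B) =>
    MeasurableSpace.comap (fun μ : SimplePointMeasure d => μ.toMeasure B) inferInstance) B hB)
    _ ⟨s, hs, rfl⟩

theorem apply_lt_top_of_isBounded (μ : SimplePointMeasure d)
    {B : Set (EuclideanSpace ℝ (Fin d))} (hB : Bornology.IsBounded B) : μ.toMeasure B < ∞ :=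
  (measure_mono subset_closure).trans_lt (μ.locally_finite _ hB.isCompact_closure)

theorem tendsto_apply_inter_closedBall (μ : SimplePointMeasure d)
    (B : Set (EuclideanSpace ℝ (Fin d))) :
    Tendsto (fun n : ℕ => μ.toMeasure (B ∩ Metric.closedBall 0 n)) atTop
      (𝓝 (μ.toMeasure B)) := by
  have h := tendsto_measure_iUnion_atTop (μ := μ.toMeasure)
    (s := fun n : ℕ => B ∩ Metric.closedBall 0 n) fun m n hmn =>
      Set.inter_subset_inter_right _ (Metric.closedBall_subset_closedBall (by exact_mod_cast hmn))
  rwa [← Set.inter_iUnion, Metric.iUnion_closedBall_nat, Set.inter_univ] at h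

/-- The σ-field `m` is arbitrary so that this applies both to the one generated by void events and
to pushforward σ-fields. Bounded sets are the useful ones because their counts are finite. -/
theorem measurable_of_isBounded {m : MeasurableSpace (SimplePointMeasure d)}
    (h : ∀ B : Set (EuclideanSpace ℝ (Fin d)), Bornology.IsBounded B → MeasurableSet B →
      Measurable[m] fun μ => μ.toMeasure B)
    {B : Set (EuclideanSpace ℝ (Fin d))} (hB : MeasurableSet B) :
    Measurable[m] fun μ : SimplePointMeasure d => μ.toMeasure B :=
  measurable_of_tendsto_metrizable
    (fun n : ℕ => h (B ∩ Metric.closedBall 0 n)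
      (Metric.isBounded_closedBall.subset Set.inter_subset_right)
      (hB.inter Metric.isClosed_closedBall.measurableSet))
    (tendsto_pi_nhds.2 fun μ => μ.tendsto_apply_inter_closedBall B)

/-- A map into the point measures is measurable as soon as all counts in bounded sets are. -/
theorem measurable_of_forall_isBounded {γ : Type*} [MeasurableSpace γ]
    {f : γ → SimplePointMeasure d}
    (h : ∀ B : Set (EuclideanSpace ℝ (Fin d)), Bornology.IsBounded B → MeasurableSet B →
      Measurable fun c => (f c).toMeasure B) : Measurable f := by
  refine measurable_iff_le_map.2 (iSup₂_le fun B hB => ?_)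
  rw [← measurable_iff_comap_le]
  refine measurable_of_isBounded (m := MeasurableSpace.map f inferInstance) ?_ hB
  exact fun B hB hBm s hs => h B hB hBm hs

/-- The events that there is no point in some bounded Borel set. -/
def voidEvents (d : ℕ) : Set (Set (SimplePointMeasure d)) :=
  {S | ∃ B : Set (EuclideanSpace ℝ (Fin d)), Bornology.IsBounded B ∧ MeasurableSet B ∧
    S = {μ | μ.toMeasure B = 0}}

theorem isPiSystem_voidEvents : IsPiSystem (voidEvents d) := by
  rintro _ ⟨A, hA, hAm, rfl⟩ _ ⟨B, hB, hBm, rfl⟩ -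
  refine ⟨A ∪ B, hA.union hB, hAm.union hBm, ?_⟩
  ext μ
  simp [measure_union_null_iff]

/-- By simplicity, the count in a bounded `B` is the pointwise limit of the number of partition
cells `C` with `C ∩ B` charged, a function of void events only. -/
theorem generateFrom_voidEvents :
    MeasurableSpace.generateFrom (voidEvents d) = (inferInstance : MeasurableSpace (SimplePointMeasure d)) := by
  refine le_antisymm (generateFrom_le ?_) (iSup₂_le fun B hB => ?_)
  · rintro _ ⟨B, -, hB, rfl⟩
    exact measurable_apply hB (measurableSet_singleton 0)
  rw [← measurable_iff_comap_le]
  refine measurable_of_isBounded (fun B hB hBm => ?_) hB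
  refine @measurable_of_tendsto_metrizable _ _ (MeasurableSpace.generateFrom (voidEvents d)) _ _ _ _
    (fun (n : ℕ) (μ : SimplePointMeasure d) =>
    ∑ C ∈ (finite_countablePartition (EuclideanSpace ℝ (Fin d)) n).toFinset,
      if μ.toMeasure (C ∩ B) = 0 then (0 : ℝ≥0∞) else 1) _ (fun n => ?_)
    (tendsto_pi_nhds.2 fun μ => ?_)
  · refine Finset.measurable_sum _ fun C hC => Measurable.ite ?_ measurable_const measurable_const
    refine measurableSet_generateFrom ⟨C ∩ B, hB.subset Set.inter_subset_right,
      (measurableSet_countablePartition n ((Set.Finite.mem_toFinset _).1 hC)).inter hBm, rfl⟩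
  · have : IsFiniteMeasure (μ.restrict B).toMeasure := ⟨by
      simpa [SimplePointMeasure.restrict] using μ.apply_lt_top_of_isBounded hB⟩
    refine tendsto_nhds_of_eventually_eq ?_
    filter_upwards [eventually_measure_univ_eq_sum_countablePartition (μ.restrict B).toMeasure
      (μ.restrict B).exists_eq_natCast (μ.restrict B).simple] with n hn
    simpa [SimplePointMeasure.restrict, Measure.restrict_apply' hBm] using hn

/-- Rényi's theorem: the law of a simple point process is determined by its void
probabilities. -/
theorem ext_of_void {Q Q' : Measure (SimplePointMeasure d)} [IsFiniteMeasure Q]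
    (h : ∀ B : Set (EuclideanSpace ℝ (Fin d)), Bornology.IsBounded B → MeasurableSet B →
      Q {μ | μ.toMeasure B = 0} = Q' {μ | μ.toMeasure B = 0}) : Q = Q' := by
  refine ext_of_generate_finite (voidEvents d) generateFrom_voidEvents.symm
    isPiSystem_voidEvents ?_ ?_
  · rintro _ ⟨B, hB, hBm, rfl⟩
    exact h B hB hBm
  -- The void event of `∅` is the whole space, so the total masses agree.
  · simpa using h ∅ Bornology.isBounded_empty MeasurableSet.empty

theorem glue_apply (F : Closeds (EuclideanSpace ℝ (Fin d))) (ν μ : SimplePointMeasure d)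
    {B : Set (EuclideanSpace ℝ (Fin d))} (hB : MeasurableSet B) :
    (glue F ν μ).toMeasure B =
      ν.toMeasure (B ∩ F) + μ.toMeasure (B ∩ (F : Set (EuclideanSpace ℝ (Fin d)))ᶜ) := by
  rw [glue, Measure.add_apply, Measure.restrict_apply hB, Measure.restrict_apply hB]

end SimplePointMeasure

namespace IsPoissonLaw

variable {d : ℕ} {lam : ℝ≥0} {Q : Measure (SimplePointMeasure d)}

theorem void_probability (hQ : IsPoissonLaw lam Q) {B : Set (EuclideanSpace ℝ (Fin d))}
    (hB : MeasurableSet B) (hBv : volume B ≠ ∞) :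
    Q {μ | μ.toMeasure B = 0} = ENNReal.ofReal (Real.exp (-(lam * (volume B).toReal))) := by
  have h := congrArg (fun m => m {0}) (hQ.count_law B hB hBv)
  rw [Measure.map_apply (SimplePointMeasure.measurable_apply hB) (measurableSet_singleton 0),
    Measure.map_apply .of_discrete (measurableSet_singleton 0)] at h
  have h0 : (fun n : ℕ => (n : ℝ≥0∞)) ⁻¹' {0} = {0} := by ext; simp
  rw [h0, poissonMeasure_singleton] at h
  refine h.trans ?_
  simp [ENNReal.coe_toNNReal_eq_toReal]

end IsPoissonLaw

/-! ### Algebra of gluing and restriction. -/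

namespace SimplePointMeasure

variable {d : ℕ}

theorem restrict_glue_of_disjoint {F : Closeds (EuclideanSpace ℝ (Fin d))}
    {H : Set (EuclideanSpace ℝ (Fin d))} (hH : Disjoint H F) (ν μ : SimplePointMeasure d) :
    (glue F ν μ).restrict H = μ.restrict H := by
  apply toMeasure_injective
  have hF : MeasurableSet (F : Set (EuclideanSpace ℝ (Fin d))) := F.isClosed.measurableSet
  simp only [restrict, glue]
  rw [Measure.restrict_add, Measure.restrict_restrict' hF, Measure.restrict_restrict' hF.compl,
    hH.inter_eq, Measure.restrict_empty, zero_add,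
    Set.inter_eq_left.2 (Set.subset_compl_iff_disjoint_right.2 hH)]

theorem restrict_restrict_of_subset {H A : Set (EuclideanSpace ℝ (Fin d))} (hA : MeasurableSet A)
    (hHA : H ⊆ A) (μ : SimplePointMeasure d) : (μ.restrict A).restrict H = μ.restrict H := by
  apply toMeasure_injective
  simp only [restrict]
  rw [Measure.restrict_restrict' hA, Set.inter_eq_left.2 hHA]

theorem restrict_glue_self (F : Closeds (EuclideanSpace ℝ (Fin d))) (ν μ : SimplePointMeasure d) :
    (glue F ν μ).restrict F = ν.restrict F := by
  apply toMeasure_injective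
  have hF : MeasurableSet (F : Set (EuclideanSpace ℝ (Fin d))) := F.isClosed.measurableSet
  simp only [restrict, glue]
  rw [Measure.restrict_add, Measure.restrict_restrict' hF, Measure.restrict_restrict' hF.compl]
  simp

/-- Here `μ.restrict ∅` serves as the zero measure; joint measurability of restriction thus follows
from that of `glue`. -/
theorem restrict_eq_glue (F : Closeds (EuclideanSpace ℝ (Fin d))) (μ : SimplePointMeasure d) :
    μ.restrict F = glue F μ (μ.restrict ∅) := by
  apply toMeasure_injective
  simp [restrict, glue]

theorem restrict_compl_eq_glue (F : Closeds (EuclideanSpace ℝ (Fin d)))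
    (μ : SimplePointMeasure d) :
    μ.restrict (F : Set (EuclideanSpace ℝ (Fin d)))ᶜ = glue F (μ.restrict ∅) μ := by
  apply toMeasure_injective
  simp [restrict, glue]

theorem measurable_restrict {A : Set (EuclideanSpace ℝ (Fin d))} (hA : MeasurableSet A) :
    Measurable fun μ : SimplePointMeasure d => μ.restrict A := by
  refine measurable_of_forall_isBounded fun B _ hB => ?_
  simp only [restrict, Measure.restrict_apply hB]
  exact measurable_apply (hB.inter hA)

theorem measurable_glue_fixed (F : Closeds (EuclideanSpace ℝ (Fin d))) :
    Measurable fun p : SimplePointMeasure d × SimplePointMeasure d => glue F p.1 p.2 := by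
  refine measurable_of_forall_isBounded fun B _ hB => ?_
  simp only [glue_apply _ _ _ hB]
  have hF : MeasurableSet (F : Set (EuclideanSpace ℝ (Fin d))) := F.isClosed.measurableSet
  exact ((measurable_apply (hB.inter hF)).comp measurable_fst).add
    ((measurable_apply (hB.inter hF.compl)).comp measurable_snd)

end SimplePointMeasure

/-! ### Discrete outer approximation of closed sets. -/

section OuterApproximation

variable {d : ℕ}

/-- The closed balls of radius `1 / (n + 1)` around the points of a dense sequence. -/
def gridBall (d n i : ℕ) : Set (EuclideanSpace ℝ (Fin d)) :=
  Metric.closedBall (denseSeq (EuclideanSpace ℝ (Fin d)) i) (1 / (n + 1))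

theorem exists_gridCover (d n : ℕ) : ∃ T : Finset ℕ,
    Metric.closedBall (0 : EuclideanSpace ℝ (Fin d)) n ⊆ ⋃ i ∈ T, gridBall d n i := by
  obtain ⟨T, hT⟩ := (isCompact_closedBall (0 : EuclideanSpace ℝ (Fin d)) n).elim_finite_subcover
    (fun i => Metric.ball (denseSeq (EuclideanSpace ℝ (Fin d)) i) (1 / (n + 1)))
    (fun i => Metric.isOpen_ball) fun x _ => by
      obtain ⟨i, hi⟩ := (denseRange_denseSeq (EuclideanSpace ℝ (Fin d))).exists_dist_lt x
        (show (0 : ℝ) < 1 / (n + 1) by positivity)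
      exact Set.mem_iUnion.2 ⟨i, hi⟩
  exact ⟨T, hT.trans (Set.iUnion₂_mono fun i _ => Metric.ball_subset_closedBall)⟩

/-- Indices of finitely many balls of radius `1 / (n + 1)` covering the ball of radius `n`. -/
noncomputable def gridCover (d n : ℕ) : Finset ℕ := (exists_gridCover d n).choose

open Classical in
/-- Indices of the covering balls which meet `F`. -/
noncomputable def hits (n : ℕ) (F : Closeds (EuclideanSpace ℝ (Fin d))) : Finset ℕ :=
  {i ∈ gridCover d n | ((F : Set (EuclideanSpace ℝ (Fin d))) ∩ gridBall d n i).Nonempty}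

theorem mem_hits {n i : ℕ} {F : Closeds (EuclideanSpace ℝ (Fin d))} :
    i ∈ hits n F ↔ i ∈ gridCover d n ∧
      ((F : Set (EuclideanSpace ℝ (Fin d))) ∩ gridBall d n i).Nonempty := by
  classical
  simp [hits]

/-- The union of the balls with indices in `S`. -/
def gridUnion (d n : ℕ) (S : Finset ℕ) : Closeds (EuclideanSpace ℝ (Fin d)) :=
  ⟨⋃ i ∈ S, gridBall d n i, S.finite_toSet.isClosed_biUnion fun _ _ => Metric.isClosed_closedBall⟩

theorem mem_gridUnion {n : ℕ} {S : Finset ℕ} {x : EuclideanSpace ℝ (Fin d)} :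
    x ∈ (gridUnion d n S : Set (EuclideanSpace ℝ (Fin d))) ↔ ∃ i ∈ S, x ∈ gridBall d n i := by
  simp [gridUnion]

theorem mem_gridUnion_hits_of_mem {n : ℕ} {F : Closeds (EuclideanSpace ℝ (Fin d))}
    {x : EuclideanSpace ℝ (Fin d)} (hx : x ∈ (F : Set (EuclideanSpace ℝ (Fin d))))
    (hxn : ‖x‖ ≤ n) : x ∈ (gridUnion d n (hits n F) : Set (EuclideanSpace ℝ (Fin d))) := by
  have h := (exists_gridCover d n).choose_spec (mem_closedBall_zero_iff.2 hxn)
  obtain ⟨i, hi, hxi⟩ := Set.mem_iUnion₂.1 h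
  exact mem_gridUnion.2 ⟨i, mem_hits.2 ⟨hi, x, hx, hxi⟩, hxi⟩

theorem exists_dist_le_of_mem_gridUnion_hits {n : ℕ} {F : Closeds (EuclideanSpace ℝ (Fin d))}
    {x : EuclideanSpace ℝ (Fin d)}
    (hx : x ∈ (gridUnion d n (hits n F) : Set (EuclideanSpace ℝ (Fin d)))) :
    ∃ y ∈ (F : Set (EuclideanSpace ℝ (Fin d))), dist x y ≤ 2 * (1 / (n + 1)) := by
  obtain ⟨i, hi, hxi⟩ := mem_gridUnion.1 hx
  obtain ⟨-, y, hy, hyi⟩ := mem_hits.1 hi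
  refine ⟨y, hy, (dist_triangle_right x y (denseSeq (EuclideanSpace ℝ (Fin d)) i)).trans ?_⟩
  have h1 := Metric.mem_closedBall.1 hxi
  have h2 := Metric.mem_closedBall.1 hyi
  linarith

/-- The balls have diameter at most 2, which is where the radius 2 in the definition of the hull
enters: already at `n = 0` the approximation avoids the hull. -/
theorem gridUnion_hits_subset (n : ℕ) (F : Closeds (EuclideanSpace ℝ (Fin d))) :
    (gridUnion d n (hits n F) : Set (EuclideanSpace ℝ (Fin d))) ⊆
      ⋃ x ∈ (F : Set (EuclideanSpace ℝ (Fin d))), Metric.closedBall x 2 := fun x hx => by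
  obtain ⟨y, hy, hxy⟩ := exists_dist_le_of_mem_gridUnion_hits hx
  refine Set.mem_iUnion₂.2 ⟨y, hy, hxy.trans ?_⟩
  have : 1 / ((n : ℝ) + 1) ≤ 1 := by
    rw [div_le_one (by positivity)]
    linarith [n.cast_nonneg (α := ℝ)]
  linarith

/-- A point of `F` is covered once `n ≥ ‖x‖`; a point outside has positive distance to the closed
set `F`, eventually more than the ball diameter. -/
theorem eventually_mem_gridUnion_hits_iff (F : Closeds (EuclideanSpace ℝ (Fin d)))
    (x : EuclideanSpace ℝ (Fin d)) :
    ∀ᶠ n in atTop, (x ∈ (gridUnion d n (hits n F) : Set (EuclideanSpace ℝ (Fin d))) ↔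
      x ∈ (F : Set (EuclideanSpace ℝ (Fin d)))) := by
  by_cases hx : x ∈ (F : Set (EuclideanSpace ℝ (Fin d)))
  · filter_upwards [eventually_ge_atTop ⌈‖x‖⌉₊] with n hn
    exact iff_of_true (mem_gridUnion_hits_of_mem hx ((Nat.le_ceil _).trans (by exact_mod_cast hn)))
      hx
  · obtain ⟨ε, hε, hball⟩ := Metric.isOpen_iff.1 F.isClosed.isOpen_compl x hx
    have ht : Tendsto (fun n : ℕ => 2 * (1 / ((n : ℝ) + 1))) atTop (𝓝 (2 * 0)) :=
      tendsto_one_div_add_atTop_nhds_zero_nat.const_mul 2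
    rw [mul_zero] at ht
    filter_upwards [ht.eventually_lt_const hε] with n hn
    refine iff_of_false (fun h => ?_) hx
    obtain ⟨y, hy, hxy⟩ := exists_dist_le_of_mem_gridUnion_hits h
    exact hball (Metric.mem_ball'.2 (hxy.trans_lt hn)) hy

/-- Grid balls are compact, so hitting one of them is a generating event of the Effros σ-field. -/
theorem measurable_hits (n : ℕ) :
    Measurable (hits n : Closeds (EuclideanSpace ℝ (Fin d)) → Finset ℕ) := by
  refine measurable_to_countable' fun S => ?_
  have : hits n ⁻¹' {S} = ⋂ i, {F : Closeds (EuclideanSpace ℝ (Fin d)) |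
      (i ∈ gridCover d n ∧ ((F : Set (EuclideanSpace ℝ (Fin d))) ∩ gridBall d n i).Nonempty) ↔
        i ∈ S} := by
    ext F
    simp [mem_hits, Finset.ext_iff]
  rw [this]
  refine MeasurableSet.iInter fun i => ?_
  have hm : MeasurableSet {F : Closeds (EuclideanSpace ℝ (Fin d)) |
      ((F : Set (EuclideanSpace ℝ (Fin d))) ∩ gridBall d n i).Nonempty} :=
    measurableSet_generateFrom ⟨_, isCompact_closedBall _ _, rfl⟩
  exact ((MeasurableSet.const _).inter hm).iff (MeasurableSet.const _)

theorem tendsto_glue_gridUnion_apply (F : Closeds (EuclideanSpace ℝ (Fin d)))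
    (ν μ : SimplePointMeasure d) {B : Set (EuclideanSpace ℝ (Fin d))}
    (hB : Bornology.IsBounded B) (hBm : MeasurableSet B) :
    Tendsto (fun n => (SimplePointMeasure.glue (gridUnion d n (hits n F)) ν μ).toMeasure B) atTop
      (𝓝 ((SimplePointMeasure.glue F ν μ).toMeasure B)) := by
  simp only [SimplePointMeasure.glue_apply _ _ _ hBm]
  refine Tendsto.add ?_ ?_
  · refine tendsto_measure_of_tendsto_indicator atTop
      (fun n => hBm.inter (gridUnion d n (hits n F)).isClosed.measurableSet) hBm
      (ν.apply_lt_top_of_isBounded hB).ne (.of_forall fun n => Set.inter_subset_left) fun x => ?_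
    filter_upwards [eventually_mem_gridUnion_hits_iff F x] with n hn
    exact and_congr_right fun _ => hn
  · refine tendsto_measure_of_tendsto_indicator atTop
      (fun n => hBm.inter (gridUnion d n (hits n F)).isClosed.measurableSet.compl) hBm
      (μ.apply_lt_top_of_isBounded hB).ne (.of_forall fun n => Set.inter_subset_left) fun x => ?_
    filter_upwards [eventually_mem_gridUnion_hits_iff F x] with n hn
    exact and_congr_right fun _ => not_congr hn

/-! ### Joint measurability of gluing and restriction. -/

namespace SimplePointMeasure

theorem measurable_glue_gridUnion_prod (n : ℕ) :
    Measurable fun q : Finset ℕ × SimplePointMeasure d × SimplePointMeasure d =>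
      glue (gridUnion d n q.1) q.2.1 q.2.2 := by
  refine measurable_from_prod_countable_right fun S => ?_
  exact measurable_glue_fixed (gridUnion d n S)

theorem measurable_glue_gridUnion (n : ℕ) :
    Measurable fun p : Closeds (EuclideanSpace ℝ (Fin d)) ×
      SimplePointMeasure d × SimplePointMeasure d =>
        glue (gridUnion d n (hits n p.1)) p.2.1 p.2.2 :=  by
  have h' : Measurable fun p : Closeds (EuclideanSpace ℝ (Fin d)) ×
      SimplePointMeasure d × SimplePointMeasure d => (hits n p.1, p.2) :=
    ((measurable_hits n).comp measurable_fst).prodMk measurable_snd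
  have := (measurable_glue_gridUnion_prod (d := d) n).comp h'
  simpa only [Function.comp_def] using this

theorem measurable_glue :
    Measurable fun p : Closeds (EuclideanSpace ℝ (Fin d)) ×
      SimplePointMeasure d × SimplePointMeasure d => glue p.1 p.2.1 p.2.2 :=
  measurable_of_forall_isBounded fun _ hB hBm =>
    measurable_of_tendsto_metrizable
      (fun n => (measurable_apply hBm).comp (measurable_glue_gridUnion n))
      (tendsto_pi_nhds.2 fun p => tendsto_glue_gridUnion_apply p.1 p.2.1 p.2.2 hB hBm)

theorem measurable_restrict_closeds :
    Measurable fun p : Closeds (EuclideanSpace ℝ (Fin d)) × SimplePointMeasure d =>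
      p.2.restrict p.1 := by
  simp only [restrict_eq_glue]
  exact measurable_glue.comp (measurable_fst.prodMk (measurable_snd.prodMk
    ((measurable_restrict MeasurableSet.empty).comp measurable_snd)))

theorem measurable_restrict_compl_closeds :
    Measurable fun p : Closeds (EuclideanSpace ℝ (Fin d)) × SimplePointMeasure d =>
      p.2.restrict (p.1 : Set (EuclideanSpace ℝ (Fin d)))ᶜ := by
  simp only [restrict_compl_eq_glue]
  exact measurable_glue.comp (measurable_fst.prodMk
    (((measurable_restrict MeasurableSet.empty).comp measurable_snd).prodMk measurable_snd))

/-- Counts are integers, so a count tending to 0 is eventually 0; this makes void events pass to the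
limit. -/
theorem eventually_apply_eq_zero_iff {m : ℕ → SimplePointMeasure d} {μ : SimplePointMeasure d}
    {B : Set (EuclideanSpace ℝ (Fin d))}
    (h : Tendsto (fun n => (m n).toMeasure B) atTop (𝓝 (μ.toMeasure B))) :
    ∀ᶠ n in atTop, ((m n).toMeasure B = 0 ↔ μ.toMeasure B = 0) := by
  by_cases h0 : μ.toMeasure B = 0
  · rw [h0] at h
    filter_upwards [h.eventually_lt_const one_pos] with n hn
    refine iff_of_true ?_ h0
    obtain ⟨k, hk⟩ := (m n).exists_eq_natCast B
    rw [hk] at hn ⊢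
    have : k < 1 := by exact_mod_cast hn
    rw [Order.lt_one_iff] at this
    simp [this]
  · filter_upwards [h.eventually_const_lt (pos_iff_ne_zero.2 h0)] with n hn
    exact iff_of_false hn.ne' h0

end SimplePointMeasure

end OuterApproximation

/-! ### The stopping-set property of selection rules. -/

namespace IsSelectionRule

variable {d : ℕ} {R : ℝ} {Ψ : SimplePointMeasure d → Closeds (EuclideanSpace ℝ (Fin d))}

theorem apply_eq_of_restrict_compl_eq (hΨ : IsSelectionRule R Ψ) {μ μ' : SimplePointMeasure d}
    {D : Closeds (EuclideanSpace ℝ (Fin d))}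
    (hD : (D : Set (EuclideanSpace ℝ (Fin d))) ⊆
      ⋃ x ∈ (Ψ μ : Set (EuclideanSpace ℝ (Fin d))), Metric.closedBall x 2)
    (h : μ.restrict (D : Set (EuclideanSpace ℝ (Fin d)))ᶜ =
      μ'.restrict (D : Set (EuclideanSpace ℝ (Fin d)))ᶜ) : Ψ μ = Ψ μ' := by
  have hH : selectionHull Ψ μ ⊆ (D : Set (EuclideanSpace ℝ (Fin d)))ᶜ :=
    Set.compl_subset_compl.2 hD
  have hDm : MeasurableSet (D : Set (EuclideanSpace ℝ (Fin d)))ᶜ :=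
    D.isClosed.measurableSet.compl
  apply hΨ.determined
  rw [← SimplePointMeasure.restrict_restrict_of_subset hDm hH μ, h,
    SimplePointMeasure.restrict_restrict_of_subset hDm hH μ']

theorem apply_glue (hΨ : IsSelectionRule R Ψ) {μ : SimplePointMeasure d}
    {D : Closeds (EuclideanSpace ℝ (Fin d))}
    (hD : (D : Set (EuclideanSpace ℝ (Fin d))) ⊆
      ⋃ x ∈ (Ψ μ : Set (EuclideanSpace ℝ (Fin d))), Metric.closedBall x 2)
    (ν : SimplePointMeasure d) : Ψ (SimplePointMeasure.glue D ν μ) = Ψ μ :=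
  (hΨ.apply_eq_of_restrict_compl_eq hD
    (SimplePointMeasure.restrict_glue_of_disjoint disjoint_compl_left ν μ).symm).symm

theorem apply_glue_self (hΨ : IsSelectionRule R Ψ) (ν μ : SimplePointMeasure d) :
    Ψ (SimplePointMeasure.glue (Ψ μ) ν μ) = Ψ μ :=
  hΨ.apply_glue (fun x hx => Set.mem_iUnion₂.2 ⟨x, hx, Metric.mem_closedBall_self zero_le_two⟩) ν

/-- The two configurations agree off the grid union of `S`. Whichever of them has hit set `S`, that
union lies in the 2-neighbourhood of its globes, so `Ψ` takes the same value on both. -/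
theorem hits_apply_glue_iff (hΨ : IsSelectionRule R Ψ) (n : ℕ) (S : Finset ℕ)
    (ν μ : SimplePointMeasure d) :
    hits n (Ψ (SimplePointMeasure.glue (gridUnion d n S) ν μ)) = S ↔ hits n (Ψ μ) = S := by
  constructor
  · intro h
    have hD := gridUnion_hits_subset n (Ψ (SimplePointMeasure.glue (gridUnion d n S) ν μ))
    rw [h] at hD
    rw [← hΨ.apply_eq_of_restrict_compl_eq hD
      (SimplePointMeasure.restrict_glue_of_disjoint disjoint_compl_left ν μ), h]
  · intro h
    have hD := gridUnion_hits_subset n (Ψ μ)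
    rw [h] at hD
    rw [hΨ.apply_glue hD, h]

end IsSelectionRule

theorem MeasureTheory.measure_eq_tsum_inter_fiber {Ω ι : Type*} [MeasurableSpace Ω]
    [MeasurableSpace ι] [Countable ι] [MeasurableSingletonClass ι] (P : Measure Ω) {f : Ω → ι}
    (hf : Measurable f) {s : Set Ω} (hs : MeasurableSet s) :
    P s = ∑' i, P (s ∩ f ⁻¹' {i}) := by
  rw [← measure_iUnion]
  · congr 1
    ext ω
    simp
  · intro i j hij
    refine Set.disjoint_left.2 fun ω h h' => hij ?_
    exact h.2.symm.trans h'.2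
  · exact fun i => hs.inter (hf (measurableSet_singleton i))

/-! ### Resampling Poisson processes. -/

section Poisson

variable {d : ℕ} {Ω : Type*} [MeasurableSpace Ω] {P : Measure Ω} {lam : ℝ≥0}
  {X W : Ω → SimplePointMeasure d}

theorem IsPoissonProcess.void_probability (hX : IsPoissonProcess lam X P)
    {B : Set (EuclideanSpace ℝ (Fin d))} (hB : MeasurableSet B) (hBv : volume B ≠ ∞) :
    P {ω | (X ω).toMeasure B = 0} = ENNReal.ofReal (Real.exp (-(lam * (volume B).toReal))) := by
  have h0 : MeasurableSet {μ : SimplePointMeasure d | μ.toMeasure B = 0} :=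
    SimplePointMeasure.measurable_apply hB (measurableSet_singleton 0)
  rw [← hX.law.void_probability hB hBv, Measure.map_apply hX.measurable h0]
  rfl

variable {R : ℝ} {Ψ : SimplePointMeasure d → Closeds (EuclideanSpace ℝ (Fin d))}

theorem IsSelectionRule.measurable_glue (hΨ : IsSelectionRule R Ψ)
    (hX : Measurable X) (hW : Measurable W) :
    Measurable fun ω => SimplePointMeasure.glue (Ψ (X ω)) (W ω) (X ω) := by
  have := (SimplePointMeasure.measurable_glue (d := d)).comp
    ((hΨ.measurable.comp hX).prodMk (hW.prodMk hX))
  simpa only [Function.comp_def] using this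

theorem IsSelectionRule.measurable_glue_gridUnion (hΨ : IsSelectionRule R Ψ)
    (hX : Measurable X) (hW : Measurable W) (n : ℕ) :
    Measurable fun ω =>
      SimplePointMeasure.glue (gridUnion d n (hits n (Ψ (X ω)))) (W ω) (X ω) := by
  have := (SimplePointMeasure.measurable_glue_gridUnion (d := d) n).comp
    ((hΨ.measurable.comp hX).prodMk (hW.prodMk hX))
  simpa only [Function.comp_def] using this

theorem IsSelectionRule.measurable_restrict (hΨ : IsSelectionRule R Ψ) :
    Measurable fun μ : SimplePointMeasure d => μ.restrict (Ψ μ) :=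
  SimplePointMeasure.measurable_restrict_closeds.comp (hΨ.measurable.prodMk measurable_id)

theorem IsSelectionRule.measurable_restrict_compl (hΨ : IsSelectionRule R Ψ) :
    Measurable fun μ : SimplePointMeasure d =>
      μ.restrict (Ψ μ : Set (EuclideanSpace ℝ (Fin d)))ᶜ :=
  SimplePointMeasure.measurable_restrict_compl_closeds.comp (hΨ.measurable.prodMk measurable_id)

variable [IsProbabilityMeasure P]

/-- Resampling a Poisson process inside a fixed closed set does not change its law. -/
theorem IsPoissonProcess.map_glue (hX : IsPoissonProcess lam X P) (hW : IsPoissonProcess lam W P)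
    (hXW : IndepFun X W P) (F : Closeds (EuclideanSpace ℝ (Fin d))) :
    P.map (fun ω => SimplePointMeasure.glue F (W ω) (X ω)) = P.map X := by
  have hm : Measurable fun ω => SimplePointMeasure.glue F (W ω) (X ω) :=
    (SimplePointMeasure.measurable_glue_fixed F).comp (hW.measurable.prodMk hX.measurable)
  have hF : MeasurableSet (F : Set (EuclideanSpace ℝ (Fin d))) := F.isClosed.measurableSet
  have := Measure.isProbabilityMeasure_map (μ := P) hm.aemeasurable
  refine SimplePointMeasure.ext_of_void fun B hB hBm => ?_
  have h0 {A : Set (EuclideanSpace ℝ (Fin d))} (hA : MeasurableSet A) :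
      MeasurableSet {μ : SimplePointMeasure d | μ.toMeasure A = 0} :=
    SimplePointMeasure.measurable_apply hA (measurableSet_singleton 0)
  have hv : volume B ≠ ∞ := hB.measure_lt_top.ne
  have hv1 : volume (B ∩ (F : Set (EuclideanSpace ℝ (Fin d)))) ≠ ∞ :=
    measure_ne_top_of_subset Set.inter_subset_left hv
  have hv2 : volume (B ∩ (F : Set (EuclideanSpace ℝ (Fin d)))ᶜ) ≠ ∞ :=
    measure_ne_top_of_subset Set.inter_subset_left hv
  rw [Measure.map_apply hm (h0 hBm), Measure.map_apply hX.measurable (h0 hBm)]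
  have hset : (fun ω => SimplePointMeasure.glue F (W ω) (X ω)) ⁻¹' {μ | μ.toMeasure B = 0} =
      X ⁻¹' {μ | μ.toMeasure (B ∩ (F : Set (EuclideanSpace ℝ (Fin d)))ᶜ) = 0} ∩
        W ⁻¹' {μ | μ.toMeasure (B ∩ F) = 0} := by
    ext ω
    simp [SimplePointMeasure.glue_apply _ _ _ hBm, and_comm]
  rw [hset, hXW.measure_inter_preimage_eq_mul _ _ (h0 (hBm.inter hF.compl)) (h0 (hBm.inter hF))]
  refine (congrArg₂ (· * ·) (hX.void_probability (hBm.inter hF.compl) hv2)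
    (hW.void_probability (hBm.inter hF) hv1)).trans ?_
  refine Eq.trans ?_ (hX.void_probability hBm hv).symm
  -- The exponentials multiply to the right one because the volumes of `B ∩ F` and `B \ F` add up to
  -- that of `B`.
  rw [← ENNReal.ofReal_mul (Real.exp_nonneg _), ← Real.exp_add, ← measure_inter_add_sdiff B hF,
    Set.sdiff_eq, ENNReal.toReal_add hv1 hv2]
  congr 2
  ring

/-- On each of the countably many fibres of `hits n (Ψ (X ω))` the resampled region is
deterministic, and the fibre is itself invariant under that resampling. -/
theorem IsSelectionRule.map_glue_gridUnion (hΨ : IsSelectionRule R Ψ)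
    (hX : IsPoissonProcess lam X P) (hW : IsPoissonProcess lam W P) (hXW : IndepFun X W P)
    (n : ℕ) :
    P.map (fun ω => SimplePointMeasure.glue (gridUnion d n (hits n (Ψ (X ω)))) (W ω) (X ω)) =
      P.map X := by
  have hm := hΨ.measurable_glue_gridUnion hX.measurable hW.measurable n
  have hh : Measurable fun μ => hits n (Ψ μ) := (measurable_hits n).comp hΨ.measurable
  refine Measure.ext fun A hA => ?_
  rw [Measure.map_apply hm hA, Measure.map_apply hX.measurable hA,
    measure_eq_tsum_inter_fiber P (hh.comp hX.measurable) (hm hA),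
    measure_eq_tsum_inter_fiber P (hh.comp hX.measurable) (hX.measurable hA)]
  refine tsum_congr fun S => ?_
  have hAS : MeasurableSet (A ∩ {μ | hits n (Ψ μ) = S}) :=
    hA.inter (hh (measurableSet_singleton S))
  have hmS : Measurable fun ω => SimplePointMeasure.glue (gridUnion d n S) (W ω) (X ω) :=
    (SimplePointMeasure.measurable_glue_fixed _).comp (hW.measurable.prodMk hX.measurable)
  -- The fixed-set result is applied to an event that includes the fibre condition;
  -- `hits_apply_glue_iff` then turns the condition on the glued process into one on `X`.
  have key := congrArg (fun m => m (A ∩ {μ | hits n (Ψ μ) = S}))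
    (hX.map_glue hW hXW (gridUnion d n S))
  rw [Measure.map_apply hmS hAS, Measure.map_apply hX.measurable hAS] at key
  refine Eq.trans (congrArg P ?_) key
  ext ω
  simp only [Set.mem_inter_iff, Set.mem_preimage, Set.mem_ofPred_eq, Set.mem_singleton_iff,
    hΨ.hits_apply_glue_iff, Function.comp_apply]
  exact and_congr_left fun h => by rw [h]

/-- Resampling a Poisson process inside the globes does not change its law. -/
theorem IsSelectionRule.map_glue (hΨ : IsSelectionRule R Ψ)
    (hX : IsPoissonProcess lam X P) (hW : IsPoissonProcess lam W P) (hXW : IndepFun X W P) :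
    P.map (fun ω => SimplePointMeasure.glue (Ψ (X ω)) (W ω) (X ω)) = P.map X := by
  have hm := hΨ.measurable_glue hX.measurable hW.measurable
  have hmn := hΨ.measurable_glue_gridUnion hX.measurable hW.measurable
  have := Measure.isProbabilityMeasure_map (μ := P) hm.aemeasurable
  refine SimplePointMeasure.ext_of_void fun B hB hBm => ?_
  have h0 : MeasurableSet {μ : SimplePointMeasure d | μ.toMeasure B = 0} :=
    SimplePointMeasure.measurable_apply hBm (measurableSet_singleton 0)
  have hconst : ∀ n, P ((fun ω =>
      SimplePointMeasure.glue (gridUnion d n (hits n (Ψ (X ω)))) (W ω) (X ω)) ⁻¹'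
        {μ | μ.toMeasure B = 0}) = P.map X {μ | μ.toMeasure B = 0} := fun n => by
    rw [← Measure.map_apply (hmn n) h0, hΨ.map_glue_gridUnion hX hW hXW n]
  rw [Measure.map_apply hm h0]
  -- The void probabilities of the approximations are constant in `n` and converge to that of the
  -- limit.
  refine tendsto_nhds_unique (tendsto_measure_of_tendsto_indicator_of_isFiniteMeasure atTop P
    (fun n => hmn n h0) fun ω => ?_) ((tendsto_congr hconst).2 tendsto_const_nhds)
  exact SimplePointMeasure.eventually_apply_eq_zero_iff
    (tendsto_glue_gridUnion_apply (Ψ (X ω)) (W ω) (X ω) hB hBm)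

/-- Disintegration of the law of the process inside and outside the globes. -/
theorem IsSelectionRule.measure_restrict_inter (hΨ : IsSelectionRule R Ψ)
    (hX : IsPoissonProcess lam X P) (hW : IsPoissonProcess lam W P) (hXW : IndepFun X W P)
    {A B : Set (SimplePointMeasure d)} {C : Set (Closeds (EuclideanSpace ℝ (Fin d)))}
    (hA : MeasurableSet A) (hB : MeasurableSet B) (hC : MeasurableSet C) :
    P ({ω | Ψ (X ω) ∈ C} ∩ {ω | (X ω).restrict (Ψ (X ω)) ∈ A ∧
      (X ω).restrict (Ψ (X ω) : Set (EuclideanSpace ℝ (Fin d)))ᶜ ∈ B}) =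
    ∫⁻ ω in {ω | Ψ (X ω) ∈ C} ∩
      {ω | (X ω).restrict (Ψ (X ω) : Set (EuclideanSpace ℝ (Fin d)))ᶜ ∈ B},
      P.map W {μ | μ.restrict (Ψ (X ω)) ∈ A} ∂P := by
  have hZ := hΨ.measurable_glue hX.measurable hW.measurable
  have := Measure.isProbabilityMeasure_map (μ := P) hW.measurable.aemeasurable
  set T : Set (SimplePointMeasure d) := {μ | Ψ μ ∈ C} ∩
    {μ | μ.restrict (Ψ μ : Set (EuclideanSpace ℝ (Fin d)))ᶜ ∈ B} with hT
  have hTm : MeasurableSet T := (hΨ.measurable hC).inter (hΨ.measurable_restrict_compl hB)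
  have hSm : MeasurableSet (T ∩ {μ | μ.restrict (Ψ μ) ∈ A}) :=
    hTm.inter (hΨ.measurable_restrict hA)
  have hU1 : MeasurableSet {p : SimplePointMeasure d × SimplePointMeasure d |
      p.2.restrict (Ψ p.1) ∈ A} :=
    SimplePointMeasure.measurable_restrict_closeds.comp
      ((hΨ.measurable.comp measurable_fst).prodMk measurable_snd) hA
  have hU : MeasurableSet (Prod.fst ⁻¹' T ∩ {p : SimplePointMeasure d × SimplePointMeasure d |
      p.2.restrict (Ψ p.1) ∈ A}) := (measurable_fst hTm).inter hU1
  have hg : Measurable fun μ : SimplePointMeasure d =>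
      P.map W {ν | ν.restrict (Ψ μ) ∈ A} := measurable_measure_prodMk_left hU1
  calc _ = P (X ⁻¹' (T ∩ {μ | μ.restrict (Ψ μ) ∈ A})) := by
        congr 1
        ext ω
        simp only [hT, Set.mem_inter_iff, Set.mem_preimage, Set.mem_ofPred_eq]
        tauto
    _ = P ((fun ω => SimplePointMeasure.glue (Ψ (X ω)) (W ω) (X ω)) ⁻¹'
          (T ∩ {μ | μ.restrict (Ψ μ) ∈ A})) := by
        rw [← Measure.map_apply hX.measurable hSm, ← hΨ.map_glue hX hW hXW,
          Measure.map_apply hZ hSm]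
    -- For the glued process, `Ψ` and the outside configuration are those of `X`, while the inside
    -- is that of `W`.
    _ = P ((fun ω => (X ω, W ω)) ⁻¹' (Prod.fst ⁻¹' T ∩
          {p : SimplePointMeasure d × SimplePointMeasure d | p.2.restrict (Ψ p.1) ∈ A})) := by
        congr 1
        ext ω
        simp only [hT, Set.mem_inter_iff, Set.mem_preimage, Set.mem_ofPred_eq,
          hΨ.apply_glue_self, SimplePointMeasure.restrict_glue_self,
          SimplePointMeasure.restrict_glue_of_disjoint disjoint_compl_left]
    _ = ∫⁻ μ in T, P.map W {ν | ν.restrict (Ψ μ) ∈ A} ∂(P.map X) := by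
        rw [← Measure.map_apply (hX.measurable.prodMk hW.measurable) hU,
          (indepFun_iff_map_prod_eq_prod_map_map hX.measurable.aemeasurable
            hW.measurable.aemeasurable).1 hXW, Measure.prod_apply hU, ← lintegral_indicator hTm]
        refine lintegral_congr fun μ => ?_
        by_cases hμ : μ ∈ T
        · rw [Set.indicator_of_mem hμ]
          congr 1
          ext ν
          simp [hμ]
        · rw [Set.indicator_of_notMem hμ]
          convert measure_empty (μ := P.map W)
          ext ν
          simp [hμ]
    _ = _ := by
        rw [setLIntegral_map hTm hg hX.measurable]
        rfl

end Poisson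

/-! ### The key equality. -/

theorem mainTheorem6 {d : ℕ} {R : ℝ} (hR : 0 < R)
    (Ψ : SimplePointMeasure d → Closeds (EuclideanSpace ℝ (Fin d))) (hΨ : IsSelectionRule R Ψ)
    {Ω : Type*} [MeasurableSpace Ω] (P : Measure Ω) [IsProbabilityMeasure P] (lam : ℝ≥0)
    (X W : Ω → SimplePointMeasure d) (hX : IsPoissonProcess lam X P)
    (hW : IsPoissonProcess lam W P) (hXW : IndepFun X W P) :
    -- `Z = W|_{Ψ(X)} + X|_{Ψ(X)ᶜ}` has the same law as `X`
    IdentDistrib (fun ω => SimplePointMeasure.glue (Ψ (X ω)) (W ω) (X ω)) X P P ∧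
    -- `Ψ(Z) = Ψ(X)`
    (∀ ω, Ψ (SimplePointMeasure.glue (Ψ (X ω)) (W ω) (X ω)) = Ψ (X ω)) ∧
    -- given `Ψ(X)`, the processes `X|_{Ψ(X)}` and `X|_{Ψ(X)ᶜ}` are independent, and the former is
    -- distributed as the restriction to `Ψ(X)` of a Poisson process independent of `X`
    (∀ A B : Set (SimplePointMeasure d), MeasurableSet A → MeasurableSet B →
      P⟦{ω | (X ω).restrict (Ψ (X ω)) ∈ A ∧
          (X ω).restrict (Ψ (X ω) : Set (EuclideanSpace ℝ (Fin d)))ᶜ ∈ B} |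
        MeasurableSpace.comap (fun ω => Ψ (X ω)) inferInstance⟧
      =ᵐ[P] fun ω =>
        P.real {ω' | (W ω').restrict (Ψ (X ω)) ∈ A} *
          (P⟦{ω' | (X ω').restrict (Ψ (X ω') : Set (EuclideanSpace ℝ (Fin d)))ᶜ ∈ B} |
            MeasurableSpace.comap (fun ω' => Ψ (X ω')) inferInstance⟧) ω) := by
  have hmap := hΨ.map_glue hX hW hXW
  have hZ := hΨ.measurable_glue hX.measurable hW.measurable
  refine ⟨⟨hZ.aemeasurable, hX.measurable.aemeasurable, hmap⟩,
    fun ω => hΨ.apply_glue_self _ _, fun A B hA hB => ?_⟩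
  have hΨX : Measurable fun ω => Ψ (X ω) := hΨ.measurable.comp hX.measurable
  -- the probability that the restriction of `W` to a closed set lies in `A`
  set g : Closeds (EuclideanSpace ℝ (Fin d)) → ℝ≥0∞ :=
    fun F => P.map W {μ | μ.restrict (F : Set (EuclideanSpace ℝ (Fin d))) ∈ A} with hg
  have hAm : MeasurableSet {p : Closeds (EuclideanSpace ℝ (Fin d)) × SimplePointMeasure d |
      p.2.restrict p.1 ∈ A} := SimplePointMeasure.measurable_restrict_closeds hA
  have := Measure.isProbabilityMeasure_map (μ := P) hW.measurable.aemeasurable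
  have hgm : Measurable g := measurable_measure_prodMk_left (ν := P.map W) hAm
  have hgX : Measurable fun ω => g (Ψ (X ω)) := hgm.comp hΨX
  have hg1 : ∀ F, g F ≤ 1 := fun F => prob_le_one
  have hgP : ∀ F : Closeds (EuclideanSpace ℝ (Fin d)),
      P.real {ω' | (W ω').restrict (F : Set (EuclideanSpace ℝ (Fin d))) ∈ A} =
      (g F).toReal := fun F => by
    have hAF : MeasurableSet {μ : SimplePointMeasure d |
        μ.restrict (F : Set (EuclideanSpace ℝ (Fin d))) ∈ A} :=
      SimplePointMeasure.measurable_restrict F.isClosed.measurableSet hA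
    exact congrArg ENNReal.toReal (Measure.map_apply hW.measurable hAF).symm
  simp only [hgP]
  set b : Set Ω := {ω | (X ω).restrict (Ψ (X ω) : Set (EuclideanSpace ℝ (Fin d)))ᶜ ∈ B} with hb
  have hbm : MeasurableSet b := hX.measurable (hΨ.measurable_restrict_compl hB)
  set ab : Set Ω := {ω | (X ω).restrict (Ψ (X ω)) ∈ A ∧
    (X ω).restrict (Ψ (X ω) : Set (EuclideanSpace ℝ (Fin d)))ᶜ ∈ B} with hab
  have habm : MeasurableSet ab := (hX.measurable (hΨ.measurable_restrict hA)).inter hbm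
  have hm : MeasurableSpace.comap (fun ω => Ψ (X ω)) inferInstance ≤ ‹MeasurableSpace Ω› :=
    hΨX.comap_le
  have hgs : StronglyMeasurable[MeasurableSpace.comap (fun ω => Ψ (X ω)) inferInstance]
      fun ω => (g (Ψ (X ω))).toReal :=
    (hgm.ennreal_toReal.comp (comap_measurable _)).stronglyMeasurable
  have hb_int : Integrable (b.indicator fun _ => (1 : ℝ)) P :=
    (integrable_const 1).indicator hbm
  have hgb_int : Integrable ((fun ω => (g (Ψ (X ω))).toReal) * b.indicator fun _ => (1 : ℝ)) P := by
    refine hb_int.bdd_mul (hgs.mono hm).aestronglyMeasurable (c := 1) (ae_of_all _ fun ω => ?_)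
    rw [Real.norm_of_nonneg ENNReal.toReal_nonneg]
    exact ENNReal.toReal_le_of_le_ofReal zero_le_one (by simpa using hg1 _)
  -- The factor `g (Ψ (X ω))` is `σ(Ψ(X))`-measurable, so it may be moved inside the conditional
  -- expectation; it remains to compare integrals over the events `Ψ(X) ∈ C`.
  refine EventuallyEq.trans ?_ (condExp_mul_of_stronglyMeasurable_left hgs hgb_int hb_int)
  refine (ae_eq_condExp_of_forall_setIntegral_eq hm hgb_int
    (fun s _ _ => integrable_condExp.integrableOn) ?_
    stronglyMeasurable_condExp.aestronglyMeasurable)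
  rintro _ ⟨C, hC, rfl⟩ -
  have hprod : ((fun ω => (g (Ψ (X ω))).toReal) * b.indicator fun _ => (1 : ℝ)) =
      b.indicator fun ω => (g (Ψ (X ω))).toReal := by
    ext ω
    by_cases hω : ω ∈ b <;> simp [hω]
  rw [setIntegral_condExp hm ((integrable_const 1).indicator habm) ⟨C, hC, rfl⟩, hprod,
    setIntegral_indicator habm, setIntegral_indicator hbm, setIntegral_const, smul_eq_mul, mul_one,
    integral_toReal hgX.aemeasurable
      (ae_of_all _ fun ω => (hg1 _).trans_lt ENNReal.one_lt_top), measureReal_def]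
  exact congrArg ENNReal.toReal (hΨ.measure_restrict_inter hX hW hXW hA hB hC)
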